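/- **Theorem 3.6.** Let $n\ge 2$ and $I=\mathbb Z/(n+1)\mathbb Z=\{0,1,\dots,n\}$. Let $C=(C_{ij})$ be the Cartan matrix of type $A_n^{(1)}$ ($C_{ii}=2$, $C_{i,i\pm1}=-1$, and $0$ otherwise), with simple roots $\alpha_i$, fundamental weights $\Lambda_i$, null root $\delta=\alpha_0+\dots+\alpha_n$, simple coroots $h_i$ and weight lattice $P=\bigoplus_i\mathbb Z\Lambda_i\oplus\mathbb Z\delta$. *Monomials.* Let $\widehat{\mathcal M}$ be the set of modified Nakajima monomials $M=\prod_{i\in I}\prod_{k\ge0}Y_{i,k}^{y_{i,k}}\mathbf 1$, where $y_{i,k}\in\mathbb Z$ and only finitely many are nonzero. Put $$\varphi_i(M)=\max_{k\ge0}\sum_{j=0}^k y_{i,j},\qquad \varepsilon_i(M)=\varphi_i(M)-\sum_{k\ge0}y_{i,k},\qquad A_{i,k}=Y_{i,k}Y_{i,k+1}Y_{i-1,k+1}^{-1}Y_{i+1,k}^{-1}.$$ Let $\widetilde f_iM=A_{i,k_f}^{-1}M$, where $k_f$ is the least $k$ with $\sum_{j=0}^k y_{i,j}=\varphi_i(M)$;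 let $\widetilde e_iM=A_{i,k_e}M$, where $k_e$ is the greatest such $k$, if $\varepsilon_i(M)>0$, and $\widetilde e_iM=0$ if $\varepsilon_i(M)=0$. Let $\mathcal M(\infty)$ be the connected component of $\mathbf 1$ in $\widehat{\mathcal M}$ under the operators $\widetilde e_i,\widetilde f_i$. *The function $D$.* There is exactly one function $D\colon\mathcal M(\infty)\to\mathbb Z$ such that $\mathcal M(\infty)$, with $\varepsilon_i,\varphi_i,\widetilde e_i,\widetilde f_i$ and $$\mathrm{wt}(M)=\sum_{i\in I}\Bigl(\sum_{k\ge0}y_{i,k}\Bigr)\Lambda_i+D(M)\,\delta ,$$ is an abstract $U_q(A_n^{(1)})$-crystal (in particular $\mathrm{wt}(\widetilde f_iM)=\mathrm{wt}(M)-\alpha_i$) and $\mathrm{wt}(\mathbf 1)=0$. Thus $D(\mathbf 1)=0$. *The algorithm.* Let $M=\prod Y_{i,k}^{y_{i,k}}\mathbf 1\in\mathcal M(\infty)$ with $M\ne\mathbf 1$. For $k\ge0$ consider the system $$a_{i,k}-a_{i-1,k}=\sum_{\ell=0}^k y_{i+\ell,\,k-\ell}\qquad(i\in I)\tag{$S_k$}$$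 in integers $a_{i,k}$, $i\in I$. 1. There is a greatest integer $m\ge0$ such that $y_{i,m+1}\ne0$ for some $i\in I$. 2. The system $(S_m)$ has exactly one solution $(a_{i,m})_{i\in I}$ such that $a_{i,m}\le0$ for all $i$ and $a_{i,m}=0$ for some $i$. Take it. 3. For $k=m-1,m-2,\dots,0$ in turn, among the solutions of $(S_k)$ such that $a_{i,k}\le0$ and $a_{i,k}\le a_{i-1,k+1}$ for all $i$ there is a greatest one in the entrywise order (for any integers $a_{i,k+1}$, $i\in I$). Take it. So the algorithm has exactly one output $(a_{i,k})_{i\in I,\,0\le k\le m}$. Put $a_{i,k}=0$ for $k>m$. There is exactly one proper reduced generalized Young wall $Y$ such that $\prod_{i\in I}\prod_{k\ge0}A_{i,k}^{-b_{i,k+1}(Y)}\mathbf 1=M$, and it satisfies $b_{i,k+1}(Y)=-a_{i,k}$ for all $i\in I$, $k\ge0$. Moreover $$D(M)=\sum_{k=0}^m a_{0,k}.$$ Here a generalized Young wall consists of finitely many boxes, placed without gaps from the right in the rows of a board whose site in the $p$th row from the bottom and the $q$th column from the right ($p,q\ge1$) has color $p-q \bmod (n+1)$, and $b_{i,k}(Y)$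 is the number of $i$-colored boxes in the $k$th column of $Y$. The wall is proper if, whenever $p>q$ and $p\equiv q \bmod (n+1)$, row $p$ has at most as many boxes as row $q$. It is reduced if there is no $k\ge1$ such that $b_{i-1,k+1}(Y)<b_{i,k}(Y)$ for all $i\in I$. -/

import Mathlib

/-!
# Modified Nakajima monomials and generalized Young walls in type `A_n^{(1)}`

The index set `I = {0, 1, ..., n}` is identified with `ZMod (n + 1)`.
-/

namespace AffineMonomial

noncomputable section

/-! ### Cartan datum -/

/-- The Cartan matrix of type `A_n^{(1)}`, for `2 ≤ n`. -/
def cartan (n : ℕ) (i j : ZMod (n + 1)) : ℤ :=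
  if i = j then 2 else if i = j + 1 ∨ j = i + 1 then -1 else 0

/-- The affine weight lattice `P`, the dual of `P^∨ = ⨁ ℤ h_i ⊕ ℤ d`.  A weight `lam` is recorded by
its values on the basis of `P^∨`: `lam.1 i = ⟨h_i, lam⟩` and `lam.2 = ⟨d, lam⟩`. -/
abbrev Weight (n : ℕ) : Type := (ZMod (n + 1) → ℤ) × ℤ

/-- The fundamental weight `Λ_i`: `⟨h_j, Λ_i⟩ = δ_{ij}` and `⟨d, Λ_i⟩ = 0`. -/
def fundWeight (n : ℕ) (i : ZMod (n + 1)) : Weight n := (Pi.single i 1, 0)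

/-- The simple root `α_j`: `⟨h_i, α_j⟩ = C_{ij}` and `⟨d, α_j⟩ = δ_{0j}`. -/
def simpleRoot (n : ℕ) (j : ZMod (n + 1)) : Weight n :=
  (fun i => cartan n i j, if j = 0 then 1 else 0)

/-- The null root `δ = α_0 + α_1 + ⋯ + α_n`. -/
def nullRoot (n : ℕ) : Weight n := ∑ i, simpleRoot n i

/-- The axioms of an abstract `U_q(g)`-crystal, for `g` of type `A_n^{(1)}`, with underlying set `B`.
The value `⊥` of `ε_i`, `φ_i` is `-∞`, and the value `none` of the Kashiwara operators is `0`. -/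
structure IsAbstractCrystal (n : ℕ) {B : Type} (wt : B → Weight n)
    (ε φ : ZMod (n + 1) → B → WithBot ℤ) (e f : ZMod (n + 1) → B → Option B) : Prop where
  phi_eq : ∀ i b, φ i b = ε i b + (((wt b).1 i : ℤ) : WithBot ℤ)
  wt_e : ∀ i b b', e i b = some b' → wt b' = wt b + simpleRoot n i
  wt_f : ∀ i b b', f i b = some b' → wt b' = wt b - simpleRoot n i
  eps_e : ∀ i b b', e i b = some b' → ε i b' = ε i b + ((-1 : ℤ) : WithBot ℤ)
  phi_e : ∀ i b b', e i b = some b' → φ i b' = φ i b + ((1 : ℤ) : WithBot ℤ)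
  eps_f : ∀ i b b', f i b = some b' → ε i b' = ε i b + ((1 : ℤ) : WithBot ℤ)
  phi_f : ∀ i b b', f i b = some b' → φ i b' = φ i b + ((-1 : ℤ) : WithBot ℤ)
  f_iff_e : ∀ i b b', f i b = some b' ↔ e i b' = some b
  bot : ∀ i b, ε i b = ⊥ → e i b = none ∧ f i b = none

/-! ### Modified Nakajima monomials -/

/-- The modified Nakajima monomial `∏ Y_{i,k}^{y_{i,k}} 𝟏` is recorded by its exponents,
`M (i, k) = y_{i,k}`.  So the product of monomials is `+`, and `𝟏` is `0`. -/
abbrev Monomial (n : ℕ) : Type := (ZMod (n + 1) × ℕ) →₀ ℤ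

/-- The weight `∑_i (∑_k y_{i,k}) Λ_i`, without its `δ`-component. -/
def clWeight {n : ℕ} (M : Monomial n) : Weight n := M.sum fun p y => y • fundWeight n p.1

/-- The partial sum `∑_{j=0}^k y_{i,j}`. -/
def partialSum {n : ℕ} (i : ZMod (n + 1)) (M : Monomial n) (k : ℕ) : ℤ :=
  ∑ j ∈ Finset.range (k + 1), M (i, j)

/-- `φ_i(M)`, the maximum of the partial sums (they are eventually constant in `k`). -/
def phi {n : ℕ} (i : ZMod (n + 1)) (M : Monomial n) : ℤ := sSup (Set.range (partialSum i M))

/-- `ε_i(M) = φ_i(M) - ⟨h_i, wt(M)⟩`. -/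
def eps {n : ℕ} (i : ZMod (n + 1)) (M : Monomial n) : ℤ := phi i M - (clWeight M).1 i

/-- The least `k` at which the maximum `φ_i(M)` is attained. -/
def kf {n : ℕ} (i : ZMod (n + 1)) (M : Monomial n) : ℕ := sInf {k | phi i M = partialSum i M k}

/-- The greatest `k` at which the maximum `φ_i(M)` is attained; used only when `ε_i(M) > 0`, and
then there is one. -/
def ke {n : ℕ} (i : ZMod (n + 1)) (M : Monomial n) : ℕ := sSup {k | phi i M = partialSum i M k}

/-- The integers `o_{i,j}` for `i ≠ j`: `o_{0,n} = 0`, `o_{n,0} = 1`, and otherwise `o_{i,j}` is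
`1` if `i < j` and `0` if `i > j`, where `i, j ∈ {0, ..., n}`. -/
def orient (n : ℕ) (i j : ZMod (n + 1)) : ℕ :=
  if i = 0 ∧ j = (n : ZMod (n + 1)) then 0
  else if i = (n : ZMod (n + 1)) ∧ j = 0 then 1
  else if i.val < j.val then 1 else 0

/-- `A_{i,k} = Y_{i,k} Y_{i,k+1} ∏_{j ≠ i} Y_{j,k+o_{j,i}}^{C_{ji}}`. -/
def A {n : ℕ} (i : ZMod (n + 1)) (k : ℕ) : Monomial n :=
  Finsupp.single (i, k) 1 + Finsupp.single (i, k + 1) 1 +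
    ∑ j ∈ Finset.univ.erase i, Finsupp.single (j, k + orient n j i) (cartan n j i)

/-- The Kashiwara operator `f_i M = A_{i,k_f}⁻¹ M`. -/
def fOp {n : ℕ} (i : ZMod (n + 1)) (M : Monomial n) : Monomial n := -A i (kf i M) + M

/-- The Kashiwara operator `e_i M`, which is `0` (here `none`) if `ε_i(M) = 0` and `A_{i,k_e} M` if
`ε_i(M) > 0`. -/
def eOp {n : ℕ} (i : ZMod (n + 1)) (M : Monomial n) : Option (Monomial n) :=
  if eps i M = 0 then none else some (A i (ke i M) + M)

/-- Membership in the connected component of `𝟏` under the Kashiwara operators. -/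
inductive InComponent {n : ℕ} : Monomial n → Prop
  | one : InComponent 0
  | f (i : ZMod (n + 1)) {M : Monomial n} : InComponent M → InComponent (fOp i M)
  | e (i : ZMod (n + 1)) {M N : Monomial n} :
      InComponent M → eOp i M = some N → InComponent N

/-- `M(∞)`. -/
def MInf (n : ℕ) : Type := {M : Monomial n // InComponent M}

/-- The element `𝟏` of `M(∞)`. -/
def MInf.one (n : ℕ) : MInf n := ⟨0, InComponent.one⟩

/-- The exponent `y_{i,k}` of `Y_{i,k}` in `M`. -/
def MInf.y {n : ℕ} (M : MInf n) (i : ZMod (n + 1)) (k : ℕ) : ℤ := M.1 (i, k)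

/-- `f_i` on `M(∞)`; its value is never `0`. -/
def MInf.f {n : ℕ} (i : ZMod (n + 1)) (M : MInf n) : Option (MInf n) :=
  some ⟨fOp i M.1, M.2.f i⟩

/-- `e_i` on `M(∞)`. -/
def MInf.e {n : ℕ} (i : ZMod (n + 1)) (M : MInf n) : Option (MInf n) :=
  (eOp i M.1).pmap (fun N hN => (⟨N, hN⟩ : MInf n)) fun _ hN => M.2.e i hN

/-- The weight `∑_i (∑_k y_{i,k}) Λ_i + D(M) δ` given by `D : M(∞) → ℤ`. -/
def MInf.wt {n : ℕ} (D : MInf n → ℤ) (M : MInf n) : Weight n :=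
  clWeight M.1 + D M • nullRoot n

/-- `D` is the `δ`-coefficient of the affine weight function of `M(∞)`: together with
`wt(M) = ∑_i (∑_k y_{i,k}) Λ_i + D(M) δ`, the set `M(∞)` is an abstract `U_q(g)`-crystal, and `𝟏`
has weight `0`, like the highest weight element of `B(∞)`. -/
def IsDeltaCoeff {n : ℕ} (D : MInf n → ℤ) : Prop :=
  MInf.wt D (MInf.one n) = 0 ∧
    IsAbstractCrystal n (MInf.wt D)
      (fun i M => ((eps i M.1 : ℤ) : WithBot ℤ)) (fun i M => ((phi i M.1 : ℤ) : WithBot ℤ))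
      MInf.e MInf.f

/-! ### Generalized Young walls -/

/-- A generalized Young wall: `Y p` is the number of boxes in row `p + 1` from the bottom; the boxes
of a row are placed from the right without gaps. -/
abbrev YoungWall : Type := ℕ →₀ ℕ

/-- The color of the site of the board in row `p + 1` from the bottom and column `q + 1` from the
right. -/
def color (n p q : ℕ) : ZMod (n + 1) := (p : ZMod (n + 1)) - (q : ZMod (n + 1))

/-- The number of `i`-colored boxes in column `k + 1` from the right. -/
def boxCount {n : ℕ} (Y : YoungWall) (i : ZMod (n + 1)) (k : ℕ) : ℕ :=
  (Y.support.filter fun p => k < Y p ∧ color n p k = i).card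

/-- Among rows whose positions are congruent modulo `n + 1`, higher rows are not longer. -/
def IsProperWall (n : ℕ) (Y : YoungWall) : Prop :=
  ∀ p q : ℕ, q < p → p ≡ q [MOD n + 1] → Y p ≤ Y q

/-- Column `k + 1` from the right contains a removable `δ`. -/
def HasRemovableDelta (n : ℕ) (Y : YoungWall) (k : ℕ) : Prop :=
  ∀ i : ZMod (n + 1), boxCount Y (i - 1) (k + 1) < boxCount Y i k

/-- No column contains a removable `δ`. -/
def IsReducedWall (n : ℕ) (Y : YoungWall) : Prop := ∀ k : ℕ, ¬ HasRemovableDelta n Y k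

/-- `Ψ(Y) = ∏_{i,k} A_{i,k}^{-a}`, where `a` is the number of `i`-colored boxes in column `k + 1`.
All columns to the left of the longest row are empty. -/
def Psi (n : ℕ) (Y : YoungWall) : Monomial n :=
  ∑ i : ZMod (n + 1), ∑ k ∈ Finset.range (Y.support.sup Y), (-(boxCount Y i k : ℤ)) • A i k

/-! ### The algorithm -/

/-- `b = (a_{i,k})_i` solves the difference system of level `k`,
`a_{i,k} - a_{i-1,k} = ∑_{ℓ=0}^k y_{i+ℓ,k-ℓ}` for all `i`. -/
def IsSolution {n : ℕ} (M : MInf n) (k : ℕ) (b : ZMod (n + 1) → ℤ) : Prop :=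
  ∀ i, b i - b (i - 1) = ∑ l ∈ Finset.range (k + 1), M.y (i + (l : ZMod (n + 1))) (k - l)

/-- The candidates at the top level `m`: the nonpositive solutions with some zero entry. -/
def topCandidates {n : ℕ} (M : MInf n) (m : ℕ) : Set (ZMod (n + 1) → ℤ) :=
  {b | IsSolution M m b ∧ (∀ i, b i ≤ 0) ∧ ∃ i, b i = 0}

/-- The candidates at level `k`, when `c = (a_{i,k+1})_i` has been found: the nonpositive solutions
with `a_{i,k} ≤ a_{i-1,k+1}` for all `i`. -/
def stepCandidates {n : ℕ} (M : MInf n) (k : ℕ) (c : ZMod (n + 1) → ℤ) :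
    Set (ZMod (n + 1) → ℤ) :=
  {b | IsSolution M k b ∧ (∀ i, b i ≤ 0) ∧ ∀ i, b i ≤ c (i - 1)}

/-- `a` is the table of the values `a k i = a_{i,k}` found by the algorithm from the top level `m`
down to level `0`, extended by zero to the levels above `m`.  The maximal solution at a level is the
greatest one in the entrywise order. -/
structure IsRun {n : ℕ} (M : MInf n) (m : ℕ) (a : ℕ → ZMod (n + 1) → ℤ) : Prop where
  top : a m ∈ topCandidates M m
  step : ∀ k, k < m → IsGreatest (stepCandidates M k (a (k + 1))) (a k)
  above : ∀ k, m < k → a k = 0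

end

end AffineMonomial

open AffineMonomial

namespace AffineMonomial

variable {n : ℕ}

/-! ### The residues modulo `n + 1` -/

/-! Write a monomial as `∏ A_{i,k}^{a_{i,k}}` and study the table `a`. Call it reduced
(`IsReducedTable`) if it is nonpositive, satisfies `a_{i,k} ≤ a_{i-1,k+1}`, and has equality for
some `i` at each level `k`.

Existence: `𝟏` has the zero table, and each Kashiwara operator changes one entry by one; the
extremality of `k_f` and `k_e` keeps the table reduced (`sub_single_kf`, `add_single_ke`). So every
element of `M(∞)` has a reduced table.

Uniqueness: diagonal sums of exponents telescope (`tableMonomial_diagonal_sum`), so the monomial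
determines each level up to an additive constant. The inequalities and the equality fix this
constant from the level above, starting where the table vanishes. This downward determination is the
algorithm itself.

Since `f_i` lowers one `i`-entry by one and `d` pairs nontrivially only with `α_0`, `D` must be the
sum of the entries `a_{0,k}`. Finally, negated box counts identify proper reduced walls with reduced
tables. -/

lemma one_ne_zero_zmod (hn : 2 ≤ n) : (1 : ZMod (n + 1)) ≠ 0 := by
  have : Fact (1 < n + 1) := ⟨by omega⟩
  exact one_ne_zero

lemma two_ne_zero_zmod (hn : 2 ≤ n) : (1 + 1 : ZMod (n + 1)) ≠ 0 := by
  intro h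
  have h2 : ((2 : ℕ) : ZMod (n + 1)) = 0 := by push_cast; rw [← h]; norm_num
  rw [ZMod.natCast_eq_zero_iff] at h2
  exact absurd (Nat.le_of_dvd (by norm_num) h2) (by omega)

lemma val_add_one_zmod (hn : 2 ≤ n) (i : ZMod (n + 1)) :
    (i + 1).val = if i = (n : ZMod (n + 1)) then 0 else i.val + 1 := by
  split_ifs with h
  · subst h
    have : ((n : ZMod (n + 1)) + 1) = ((n + 1 : ℕ) : ZMod (n + 1)) := by push_cast; rfl
    rw [this, ZMod.natCast_self, ZMod.val_zero]
  · have : Fact (1 < n + 1) := ⟨by omega⟩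
    have hlt := ZMod.val_lt i
    have hne : i.val ≠ n := fun h' =>
      h ((ZMod.natCast_zmod_val i).symm.trans (congrArg (Nat.cast (R := ZMod (n + 1))) h'))
    rw [ZMod.val_add_of_lt, ZMod.val_one]
    rw [ZMod.val_one]; omega

/-- Applied to differences of two solutions of one difference system: they are constant because `1`
generates `ZMod (n + 1)`. -/
lemma apply_eq_of_forall_sub_one {β : Type*} {g : ZMod (n + 1) → β} (h : ∀ i, g i = g (i - 1))
    (i j : ZMod (n + 1)) : g i = g j := by
  have key : ∀ m : ℕ, g (m : ZMod (n + 1)) = g 0 := by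
    intro m
    induction m with
    | zero => simp
    | succ m ih => rw [h, ← ih]; push_cast; congr 1; ring
  rw [← ZMod.natCast_zmod_val i, ← ZMod.natCast_zmod_val j, key, key]

/-! ### The monomials `A_{i,k}` -/

lemma orient_sub_one (hn : 2 ≤ n) (i : ZMod (n + 1)) : orient n (i - 1) i = 1 := by
  obtain ⟨j, rfl⟩ : ∃ j, i = j + 1 := ⟨i - 1, by ring⟩
  have hv := val_add_one_zmod hn j
  rw [add_sub_cancel_right]
  unfold orient
  split_ifs at hv with h
  · subst h
    have h0 : (n : ZMod (n + 1)) + 1 = 0 := by rwa [ZMod.val_eq_zero] at hv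
    have h1 : (0 : ZMod (n + 1)) ≠ n := fun h => one_ne_zero_zmod hn (by rw [← h] at h0; simpa using h0)
    simp [h0, h1]
  · have h1 : ¬ (j = 0 ∧ j + 1 = (n : ZMod (n + 1))) := by
      rintro ⟨rfl, h1⟩
      rw [h1, ZMod.val_zero, ZMod.val_natCast_of_lt (by omega)] at hv
      omega
    rw [if_neg h1, if_neg (fun h' => h h'.1), if_pos (by omega)]

lemma orient_add_one (hn : 2 ≤ n) (i : ZMod (n + 1)) : orient n (i + 1) i = 0 := by
  have hv := val_add_one_zmod hn i
  unfold orient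
  split_ifs at hv with h
  · rw [if_pos ⟨by rwa [ZMod.val_eq_zero] at hv, h⟩]
  · have h1 : ¬ (i + 1 = (n : ZMod (n + 1)) ∧ i = 0) := by
      rintro ⟨h1, rfl⟩
      rw [h1, ZMod.val_zero, ZMod.val_natCast_of_lt (by omega)] at hv
      omega
    rw [if_neg (fun h' => h h'.2), if_neg h1, if_neg (by omega)]

lemma sub_one_ne_self (hn : 2 ≤ n) (i : ZMod (n + 1)) : i - 1 ≠ i := fun h =>
  one_ne_zero_zmod hn (by linear_combination -h)

lemma add_one_ne_self (hn : 2 ≤ n) (i : ZMod (n + 1)) : i + 1 ≠ i := fun h =>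
  one_ne_zero_zmod hn (by linear_combination h)

lemma add_one_ne_sub_one (hn : 2 ≤ n) (i : ZMod (n + 1)) : i + 1 ≠ i - 1 := fun h =>
  two_ne_zero_zmod hn (by linear_combination h)

/-- For `n ≥ 2` the residues `i - 1`, `i`, `i + 1` are distinct, so exactly two neighbours
contribute, each with Cartan entry `-1`; the orientation shifts only `i - 1`. -/
lemma A_eq (hn : 2 ≤ n) (i : ZMod (n + 1)) (k : ℕ) :
    A i k = Finsupp.single (i, k) 1 + Finsupp.single (i, k + 1) 1
      - Finsupp.single (i - 1, k + 1) 1 - Finsupp.single (i + 1, k) 1 := by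
  have hm := sub_one_ne_self hn i
  have hp := add_one_ne_self hn i
  have hpm := add_one_ne_sub_one hn i
  have hsum : ∑ j ∈ Finset.univ.erase i, Finsupp.single (j, k + orient n j i) (cartan n j i)
      = ∑ j ∈ ({i - 1, i + 1} : Finset (ZMod (n + 1))),
        Finsupp.single (j, k + orient n j i) (cartan n j i) := by
    symm
    apply Finset.sum_subset
    · intro j hj
      simp only [Finset.mem_insert, Finset.mem_singleton] at hj
      rcases hj with rfl | rfl <;> simp [hm, one_ne_zero_zmod hn]
    · intro j hj hj'
      simp only [Finset.mem_insert, Finset.mem_singleton, not_or] at hj'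
      have hji : j ≠ i := Finset.ne_of_mem_erase hj
      have h2 : ¬ (j = i + 1 ∨ i = j + 1) := by
        rintro (h | h)
        · exact hj'.2 h
        · exact hj'.1 (by rw [h]; ring)
      rw [cartan, if_neg hji, if_neg h2, Finsupp.single_zero]
  have c1 : cartan n (i - 1) i = -1 := by
    rw [cartan, if_neg hm, if_pos (Or.inr (by ring))]
  have c2 : cartan n (i + 1) i = -1 := by
    rw [cartan, if_neg hp, if_pos (Or.inl rfl)]
  rw [A, hsum, Finset.sum_pair hpm.symm, orient_sub_one hn, orient_add_one hn, c1, c2,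
    Finsupp.single_neg, Finsupp.single_neg, add_zero]
  abel

/-! ### Weights -/

lemma clWeight_eq_linearCombination (M : Monomial n) :
    clWeight M = Finsupp.linearCombination ℤ (fun p : ZMod (n + 1) × ℕ => fundWeight n p.1) M :=
  rfl

lemma clWeight_add (M N : Monomial n) : clWeight (M + N) = clWeight M + clWeight N := by
  simp only [clWeight_eq_linearCombination, map_add]

lemma clWeight_neg (M : Monomial n) : clWeight (-M) = -clWeight M := by
  simp only [clWeight_eq_linearCombination, map_neg]

lemma clWeight_A (hn : 2 ≤ n) (i : ZMod (n + 1)) (k : ℕ) :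
    clWeight (A i k) = (fun j => cartan n j i, 0) := by
  have hm := sub_one_ne_self hn i
  have hp := add_one_ne_self hn i
  have hpm := add_one_ne_sub_one hn i
  rw [A_eq hn, clWeight_eq_linearCombination]
  simp only [map_add, map_sub, Finsupp.linearCombination_single, one_smul, fundWeight]
  refine Prod.ext ?_ (by simp)
  funext j
  simp only [Prod.fst_add, Prod.fst_sub, Pi.add_apply, Pi.sub_apply, Pi.single_apply, cartan]
  have h3 : (i = j + 1) ↔ (j = i - 1) := by rw [eq_sub_iff_add_eq, eq_comm]
  simp only [h3]
  by_cases h1 : j = i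
  · subst h1; simp [hm.symm, hp.symm]
  · by_cases h2 : j = i - 1
    · subst h2; simp [h1, hpm.symm]
    · by_cases h4 : j = i + 1
      · subst h4; simp [h1, hpm]
      · simp [h1, h2, h4]

lemma clWeight_snd (M : Monomial n) : (clWeight M).2 = 0 := by
  simp [clWeight, Finsupp.sum, Prod.snd_sum, fundWeight]

lemma nullRoot_eq (hn : 2 ≤ n) : nullRoot n = (0, 1) := by
  refine Prod.ext ?_ (by simp [nullRoot, simpleRoot, Prod.snd_sum])
  funext j
  -- A row of the Cartan matrix as a signed sum of indicators, so that its total is `1 + 1 - 1 - 1`.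
  have hrow : ∀ i, (simpleRoot n i).1 j = (Pi.single (M := fun _ => ℤ) j 1 i + Pi.single (M := fun _ => ℤ) j 1 i
      - Pi.single (M := fun _ => ℤ) (j + 1) 1 i - Pi.single (M := fun _ => ℤ) (j - 1) 1 i : ℤ) := by
    intro i
    have hm := sub_one_ne_self hn j
    have hp := add_one_ne_self hn j
    have hpm := add_one_ne_sub_one hn j
    simp only [simpleRoot, cartan, Pi.single_apply]
    have h3 : (j = i + 1) ↔ (i = j - 1) := by rw [eq_sub_iff_add_eq, eq_comm]
    simp only [h3, eq_comm (a := j) (b := i)]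
    by_cases h1 : i = j
    · subst h1; simp [hm.symm, hp.symm]
    · by_cases h2 : i = j - 1
      · subst h2; simp [h1, hpm.symm]
      · by_cases h4 : i = j + 1
        · subst h4; simp [h1, hpm]
        · simp [h1, h2, h4]
  simp only [nullRoot, Prod.fst_sum, Finset.sum_apply, hrow, Finset.sum_sub_distrib,
    Finset.sum_add_distrib, Finset.sum_pi_single', Finset.mem_univ, if_true, Pi.zero_apply]
  norm_num

lemma wt_eq (hn : 2 ≤ n) (D : MInf n → ℤ) (M : MInf n) :
    MInf.wt D M = ((clWeight M.1).1, D M) := by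
  rw [MInf.wt, nullRoot_eq hn]
  refine Prod.ext ?_ ?_ <;> simp [clWeight_snd]

/-! ### Partial sums and the Kashiwara operators -/

lemma partialSum_add (i : ZMod (n + 1)) (M N : Monomial n) (k : ℕ) :
    partialSum i (M + N) k = partialSum i M k + partialSum i N k := by
  simp [partialSum, Finset.sum_add_distrib]

lemma partialSum_neg (i : ZMod (n + 1)) (M : Monomial n) (k : ℕ) :
    partialSum i (-M) k = -partialSum i M k := by
  simp [partialSum]

lemma partialSum_single_self (i : ZMod (n + 1)) (k j : ℕ) :
    partialSum i (Finsupp.single (i, k) 1) j = if k ≤ j then 1 else 0 := by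
  simp [partialSum, Finsupp.single_apply]

lemma partialSum_single_of_ne {i i' : ZMod (n + 1)} (h : i' ≠ i) (k j : ℕ) :
    partialSum i (Finsupp.single (i', k) 1) j = 0 := by
  simp [partialSum, h]

lemma partialSum_succ (i : ZMod (n + 1)) (M : Monomial n) (k : ℕ) :
    partialSum i M (k + 1) = partialSum i M k + M (i, k + 1) := by
  rw [partialSum, Finset.sum_range_succ, ← partialSum]

lemma partialSum_A (hn : 2 ≤ n) (i : ZMod (n + 1)) (k j : ℕ) :
    partialSum i (A i k) j = (if k ≤ j then 1 else 0) + (if k + 1 ≤ j then 1 else 0) := by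
  rw [A_eq hn, sub_eq_add_neg, sub_eq_add_neg, partialSum_add, partialSum_add, partialSum_add,
    partialSum_neg, partialSum_neg, partialSum_single_self, partialSum_single_self,
    partialSum_single_of_ne (sub_one_ne_self hn i), partialSum_single_of_ne (add_one_ne_self hn i)]
  ring

lemma exists_forall_level_eq_zero {κ β : Type*} [Zero β] (M : (κ × ℕ) →₀ β) :
    ∃ N, ∀ i k, N ≤ k → M (i, k) = 0 := by
  refine ⟨M.support.sup Prod.snd + 1, fun i k hk => ?_⟩
  by_contra h
  have := Finset.le_sup (f := Prod.snd) (Finsupp.mem_support_iff.2 h)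
  simp only at this
  omega

lemma partialSum_eq_of_le {i : ZMod (n + 1)} {M : Monomial n} {N : ℕ}
    (hN : ∀ k, N ≤ k → M (i, k) = 0) {k : ℕ} (hk : N ≤ k) :
    partialSum i M k = partialSum i M N := by
  induction k, hk using Nat.le_induction with
  | base => rfl
  | succ k hk ih => rw [partialSum_succ, ih, hN _ (by omega), add_zero]

lemma linearCombination_eq_sum {V : Type*} [AddCommGroup V] {κ : Type*} [Fintype κ]
    (g : κ × ℕ → V) (a : (κ × ℕ) →₀ ℤ) {N : ℕ} (hN : ∀ i k, N ≤ k → a (i, k) = 0) :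
    Finsupp.linearCombination ℤ g a = ∑ i, ∑ k ∈ Finset.range N, a (i, k) • g (i, k) := by
  rw [Finsupp.linearCombination_apply, ← Finset.sum_product']
  refine Finsupp.sum_of_support_subset a (fun p hp => ?_) _ (by simp)
  rw [Finset.mem_product]
  refine ⟨Finset.mem_univ _, ?_⟩
  rw [Finset.mem_range]
  by_contra h
  exact Finsupp.mem_support_iff.1 hp (hN p.1 p.2 (by omega))

lemma clWeight_fst {i : ZMod (n + 1)} {M : Monomial n} {N : ℕ}
    (hN : ∀ i k, N ≤ k → M (i, k) = 0) : (clWeight M).1 i = partialSum i M N := by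
  rw [partialSum, clWeight_eq_linearCombination, linearCombination_eq_sum (N := N + 1)]
  · simp only [Prod.fst_sum, Finset.sum_apply, fundWeight, Prod.smul_fst, Pi.smul_apply,
      Pi.single_apply, smul_eq_mul, mul_ite, mul_one, mul_zero]
    rw [Finset.sum_comm]
    simp
  · exact fun i k hk => hN i k (by omega)

lemma exists_isMax_partialSum (i : ZMod (n + 1)) (M : Monomial n) :
    ∃ k, ∀ j, partialSum i M j ≤ partialSum i M k := by
  obtain ⟨N, hN⟩ := exists_forall_level_eq_zero M
  obtain ⟨k, -, hk⟩ := Finset.exists_max_image (Finset.range (N + 1)) (partialSum i M) ⟨0, by simp⟩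
  refine ⟨k, fun j => ?_⟩
  rcases le_total N j with h | h
  · rw [partialSum_eq_of_le (hN i) h]; exact hk N (by simp)
  · exact hk j (by simp; omega)

lemma phi_eq_of_isMax {i : ZMod (n + 1)} {M : Monomial n} {k : ℕ}
    (hk : ∀ j, partialSum i M j ≤ partialSum i M k) : phi i M = partialSum i M k :=
  IsGreatest.csSup_eq ⟨⟨k, rfl⟩, by rintro _ ⟨j, rfl⟩; exact hk j⟩

lemma partialSum_le_phi (i : ZMod (n + 1)) (M : Monomial n) (k : ℕ) :
    partialSum i M k ≤ phi i M := by
  obtain ⟨k', hk'⟩ := exists_isMax_partialSum i M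
  rw [phi_eq_of_isMax hk']; exact hk' k

lemma phi_eq_partialSum_kf (i : ZMod (n + 1)) (M : Monomial n) :
    phi i M = partialSum i M (kf i M) := by
  obtain ⟨k', hk'⟩ := exists_isMax_partialSum i M
  exact Nat.sInf_mem (s := {k | phi i M = partialSum i M k}) ⟨k', phi_eq_of_isMax hk'⟩

lemma partialSum_lt_of_lt_kf {i : ZMod (n + 1)} {M : Monomial n} {j : ℕ} (hj : j < kf i M) :
    partialSum i M j < phi i M :=
  lt_of_le_of_ne (partialSum_le_phi i M j) fun h => Nat.notMem_of_lt_sInf hj h.symm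

lemma eps_nonneg (i : ZMod (n + 1)) (M : Monomial n) : 0 ≤ eps i M := by
  obtain ⟨N, hN⟩ := exists_forall_level_eq_zero M
  rw [eps, clWeight_fst hN, sub_nonneg]
  exact partialSum_le_phi i M N

lemma phi_eq_partialSum_ke_and_lt {i : ZMod (n + 1)} {M : Monomial n} (h : eps i M ≠ 0) :
    phi i M = partialSum i M (ke i M) ∧ ∀ j, ke i M < j → partialSum i M j < phi i M := by
  obtain ⟨N, hN⟩ := exists_forall_level_eq_zero M
  -- A maximiser beyond `N` would make the eventual value maximal, that is `eps i M = 0`.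
  -- Boundedness matters because `sSup` of an unbounded set of naturals is `0`.
  have hbdd : BddAbove {k | phi i M = partialSum i M k} := by
    refine ⟨N, fun k hk => ?_⟩
    by_contra hkN
    apply h
    rw [eps, clWeight_fst hN, ← partialSum_eq_of_le (hN i) (le_of_not_ge hkN), ← hk, sub_self]
  refine ⟨Nat.sSup_mem (s := {k | phi i M = partialSum i M k})
    ⟨_, phi_eq_partialSum_kf i M⟩ hbdd, fun j hj => ?_⟩
  exact lt_of_le_of_ne (partialSum_le_phi i M j) fun h' => (le_csSup hbdd h'.symm).not_gt hj

/-- Partial sums drop by 1 at `kf` and by 2 after it, while those before `kf` were already below the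
maximum. So the new maximum is one less and is last attained at `kf`. -/
lemma phi_fOp_and_ke_fOp (hn : 2 ≤ n) (i : ZMod (n + 1)) (M : Monomial n) :
    phi i (fOp i M) = phi i M - 1 ∧ ke i (fOp i M) = kf i M := by
  have hs : ∀ j, partialSum i (fOp i M) j = partialSum i M j
      - ((if kf i M ≤ j then 1 else 0) + (if kf i M + 1 ≤ j then 1 else 0)) := by
    intro j
    rw [fOp, partialSum_add, partialSum_neg, partialSum_A hn]; ring
  have hkf := phi_eq_partialSum_kf i M
  have h0 : partialSum i (fOp i M) (kf i M) = phi i M - 1 := by rw [hs, ← hkf]; simp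
  have hlt : ∀ j, partialSum i (fOp i M) j ≤ phi i M - 1 ∧
      (kf i M < j → partialSum i (fOp i M) j < phi i M - 1) := by
    intro j
    rw [hs]
    have h1 := partialSum_le_phi i M j
    rcases lt_or_ge j (kf i M) with h2 | h2
    · have := partialSum_lt_of_lt_kf h2
      rw [if_neg (by omega), if_neg (by omega)]
      omega
    · split_ifs <;> omega
  have hphi : phi i (fOp i M) = phi i M - 1 := by
    rw [phi_eq_of_isMax (k := kf i M) (fun j => by rw [h0]; exact (hlt j).1), h0]
  refine ⟨hphi, IsGreatest.csSup_eq ⟨by rw [Set.mem_ofPred_eq, hphi, h0], fun j hj => ?_⟩⟩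
  rw [Set.mem_ofPred_eq, hphi] at hj
  by_contra hcon
  exact ((hlt j).2 (not_le.1 hcon)).ne hj.symm

/-- The mirror image: sums after `ke` rise by 2 but started at least 1 below the maximum, so `ke`
becomes the first maximiser. -/
lemma kf_A_ke_add (hn : 2 ≤ n) {i : ZMod (n + 1)} {M : Monomial n} (h : eps i M ≠ 0) :
    kf i (A i (ke i M) + M) = ke i M := by
  set k := ke i M with hk
  obtain ⟨hke, hlt⟩ := phi_eq_partialSum_ke_and_lt h
  rw [← hk] at hke hlt
  have hs : ∀ j, partialSum i (A i k + M) j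
      = ((if k ≤ j then 1 else 0) + (if k + 1 ≤ j then 1 else 0)) + partialSum i M j := by
    intro j
    rw [partialSum_add, partialSum_A hn]
  have h0 : partialSum i (A i k + M) k = phi i M + 1 := by
    rw [hs, ← hke]; simp [add_comm]
  have hbd : ∀ j, partialSum i (A i k + M) j ≤ phi i M + 1 ∧
      (j < k → partialSum i (A i k + M) j < phi i M + 1) := by
    intro j
    rw [hs]
    have h1 := partialSum_le_phi i M j
    have h2 := hlt j
    split_ifs <;> omega
  have hphi : phi i (A i k + M) = phi i M + 1 := by
    rw [phi_eq_of_isMax (k := k) (fun j => by rw [h0]; exact (hbd j).1), h0]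
  refine IsLeast.csInf_eq ⟨by rw [Set.mem_ofPred_eq, hphi, h0], fun j hj => ?_⟩
  rw [Set.mem_ofPred_eq, hphi] at hj
  by_contra hcon
  exact ((hbd j).2 (not_le.1 hcon)).ne hj.symm

lemma clWeight_fOp (hn : 2 ≤ n) (i j : ZMod (n + 1)) (M : Monomial n) :
    (clWeight (fOp i M)).1 j = (clWeight M).1 j - cartan n j i := by
  rw [fOp, clWeight_add, clWeight_neg, clWeight_A hn]
  simp only [Prod.fst_add, Prod.fst_neg, Pi.add_apply, Pi.neg_apply]
  ring

lemma eps_fOp (hn : 2 ≤ n) (i : ZMod (n + 1)) (M : Monomial n) :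
    eps i (fOp i M) = eps i M + 1 := by
  have h : cartan n i i = 2 := if_pos rfl
  rw [eps, eps, (phi_fOp_and_ke_fOp hn i M).1, clWeight_fOp hn, h]
  ring

lemma eOp_eq_some_iff (hn : 2 ≤ n) (i : ZMod (n + 1)) (M N : Monomial n) :
    eOp i N = some M ↔ fOp i M = N := by
  constructor
  · intro h
    rw [eOp] at h
    split_ifs at h with h0
    have h' := Option.some.inj h
    subst h'
    rw [fOp, kf_A_ke_add hn h0, neg_add_cancel_left]
  · rintro rfl
    have h0 : eps i (fOp i M) ≠ 0 := by
      rw [eps_fOp hn]; have := eps_nonneg i M; omega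
    rw [eOp, if_neg h0, (phi_fOp_and_ke_fOp hn i M).2, fOp, add_neg_cancel_left]

lemma MInf.f_eq_some_iff (i : ZMod (n + 1)) (M N : MInf n) :
    MInf.f i M = some N ↔ fOp i M.1 = N.1 :=
  ⟨fun h => congrArg Subtype.val (Option.some.inj h), fun h => congrArg some (Subtype.ext h)⟩

lemma MInf.e_eq_some_iff (i : ZMod (n + 1)) (M N : MInf n) :
    MInf.e i M = some N ↔ eOp i M.1 = some N.1 := by
  refine Option.pmap_eq_some_iff.trans ⟨?_, fun h => ⟨N.1, N.2, h, rfl⟩⟩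
  rintro ⟨a, ha, h, rfl⟩
  exact h

/-- The axioms for `e` follow from those for `f` because the two are mutually inverse, so `D` is
constrained only through the `d`-component of the weight. -/
lemma isAbstractCrystal_of_fOp (hn : 2 ≤ n) {D : MInf n → ℤ}
    (hD : ∀ i M N, fOp i M.1 = N.1 → D N = D M - if i = 0 then 1 else 0) :
    IsAbstractCrystal n (MInf.wt D)
      (fun i M => ((eps i M.1 : ℤ) : WithBot ℤ)) (fun i M => ((phi i M.1 : ℤ) : WithBot ℤ))
      MInf.e MInf.f := by
  have hfe : ∀ i (b b' : MInf n), MInf.f i b = some b' ↔ MInf.e i b' = some b := fun i b b' => by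
    rw [MInf.f_eq_some_iff, MInf.e_eq_some_iff, eOp_eq_some_iff hn]
  have hwt : ∀ i (b b' : MInf n), MInf.f i b = some b' →
      MInf.wt D b' = MInf.wt D b - simpleRoot n i := by
    intro i b b' h
    rw [MInf.f_eq_some_iff] at h
    rw [wt_eq hn, wt_eq hn, hD i b b' h, ← h]
    refine Prod.ext ?_ (by simp [simpleRoot])
    funext j
    simp [simpleRoot, clWeight_fOp hn]
  have heps : ∀ i (b b' : MInf n), MInf.f i b = some b' → eps i b'.1 = eps i b.1 + 1 := by
    intro i b b' h
    rw [MInf.f_eq_some_iff] at h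
    rw [← h, eps_fOp hn]
  have hphi : ∀ i (b b' : MInf n), MInf.f i b = some b' → phi i b'.1 = phi i b.1 + -1 := by
    intro i b b' h
    rw [MInf.f_eq_some_iff] at h
    rw [← h, (phi_fOp_and_ke_fOp hn i b.1).1]; rfl
  refine ⟨?_, ?_, hwt, ?_, ?_, ?_, ?_, hfe, ?_⟩
  · intro i b
    rw [← WithBot.coe_add, wt_eq hn, eps]
    congr 1
    ring
  · intro i b b' h
    rw [hwt i b' b ((hfe _ _ _).2 h), sub_add_cancel]
  · intro i b b' h
    rw [← WithBot.coe_add, heps i b' b ((hfe _ _ _).2 h)]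
    congr 1; ring
  · intro i b b' h
    rw [← WithBot.coe_add, hphi i b' b ((hfe _ _ _).2 h)]
    congr 1; ring
  · intro i b b' h
    rw [← WithBot.coe_add, heps i b b' h]
  · intro i b b' h
    rw [← WithBot.coe_add, hphi i b b' h]
  · intro i b h
    exact absurd h (WithBot.coe_ne_bot)

/-! ### Exponent tables -/

noncomputable section

/-- The monomial `∏ A_{i,k}^{a_{i,k}}`. -/
def tableMonomial (a : (ZMod (n + 1) × ℕ) →₀ ℤ) : Monomial n :=
  Finsupp.linearCombination ℤ (fun p : ZMod (n + 1) × ℕ => A p.1 p.2) a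

/-- The sum `∑_k a_{0,k}`. -/
def tableDelta (a : (ZMod (n + 1) × ℕ) →₀ ℤ) : ℤ :=
  Finsupp.linearCombination ℤ (fun p : ZMod (n + 1) × ℕ => if p.1 = 0 then (1 : ℤ) else 0) a

end

/-- The table `a_{i,k} = -b_{i,k+1}(Y)` of a proper reduced generalized Young wall `Y`. -/
structure IsReducedTable (a : (ZMod (n + 1) × ℕ) →₀ ℤ) : Prop where
  nonpos : ∀ i k, a (i, k) ≤ 0
  le_left : ∀ i k, a (i, k) ≤ a (i - 1, k + 1)
  exists_eq : ∀ k, ∃ i, a (i, k) = a (i - 1, k + 1)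

lemma tableMonomial_add (a b : (ZMod (n + 1) × ℕ) →₀ ℤ) :
    tableMonomial (a + b) = tableMonomial a + tableMonomial b := map_add _ a b

lemma tableMonomial_sub (a b : (ZMod (n + 1) × ℕ) →₀ ℤ) :
    tableMonomial (a - b) = tableMonomial a - tableMonomial b := map_sub _ a b

lemma tableMonomial_single (i : ZMod (n + 1)) (k : ℕ) (c : ℤ) :
    tableMonomial (Finsupp.single (i, k) c) = c • A i k :=
  Finsupp.linearCombination_single ..

lemma A_apply (hn : 2 ≤ n) (i' i : ZMod (n + 1)) (k' k : ℕ) :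
    A i' k' (i, k) = (if k' = k then (if i' = i then 1 else 0) - (if i' = i - 1 then 1 else 0) else 0)
      + (if k' + 1 = k then (if i' = i then 1 else 0) - (if i' = i + 1 then 1 else 0) else 0) := by
  rw [A_eq hn]
  simp only [Finsupp.add_apply, Finsupp.sub_apply, Finsupp.single_apply, Prod.mk.injEq,
    sub_eq_iff_eq_add, ← eq_sub_iff_add_eq]
  by_cases h : k' = k <;> by_cases h' : k' + 1 = k <;> simp [h, h']

lemma tableMonomial_apply_zero (hn : 2 ≤ n) (a : (ZMod (n + 1) × ℕ) →₀ ℤ) (i : ZMod (n + 1)) :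
    tableMonomial a (i, 0) = a (i, 0) - a (i - 1, 0) := by
  induction a using Finsupp.induction_linear with
  | zero => simp [tableMonomial]
  | add f g hf hg => rw [tableMonomial_add, Finsupp.add_apply, hf, hg]; simp only [Finsupp.add_apply]; ring
  | single p c =>
    obtain ⟨i', k'⟩ := p
    rw [tableMonomial_single, Finsupp.smul_apply, A_apply hn]
    simp only [Finsupp.single_apply, Prod.mk.injEq]
    by_cases h : k' = 0 <;> simp [h, mul_sub]

lemma tableMonomial_apply_succ (hn : 2 ≤ n) (a : (ZMod (n + 1) × ℕ) →₀ ℤ) (i : ZMod (n + 1))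
    (k : ℕ) : tableMonomial a (i, k + 1)
      = (a (i, k + 1) - a (i - 1, k + 1)) - (a (i + 1, k) - a (i, k)) := by
  induction a using Finsupp.induction_linear with
  | zero => simp [tableMonomial]
  | add f g hf hg => rw [tableMonomial_add, Finsupp.add_apply, hf, hg]; simp only [Finsupp.add_apply]; ring
  | single p c =>
    obtain ⟨i', k'⟩ := p
    rw [tableMonomial_single, Finsupp.smul_apply, A_apply hn]
    simp only [Finsupp.single_apply, Prod.mk.injEq, add_left_inj]
    by_cases h : k' = k + 1
    · have h' : ¬ k' = k := by omega
      simp [h, mul_sub]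
    · by_cases h' : k' = k <;> simp [h, h', mul_sub]

/-- The exponent at `(i, k + 1)` is the difference at `(i, k + 1)` minus the one at `(i + 1, k)`, so
summing along the diagonal telescopes. -/
lemma tableMonomial_diagonal_sum (hn : 2 ≤ n) (a : (ZMod (n + 1) × ℕ) →₀ ℤ) (k : ℕ)
    (i : ZMod (n + 1)) : a (i, k) - a (i - 1, k)
      = ∑ l ∈ Finset.range (k + 1), tableMonomial a (i + (l : ZMod (n + 1)), k - l) := by
  induction k generalizing i with
  | zero => simp [tableMonomial_apply_zero hn]
  | succ k ih =>
    rw [Finset.sum_range_succ']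
    have h : ∀ l : ℕ, tableMonomial a (i + ((l + 1 : ℕ) : ZMod (n + 1)), k + 1 - (l + 1))
        = tableMonomial a (i + 1 + (l : ZMod (n + 1)), k - l) := by
      intro l
      rw [Nat.add_sub_add_right]; push_cast
      rw [add_comm (l : ZMod (n + 1)) 1, add_assoc]
    simp only [h]
    rw [← ih (i + 1), Nat.cast_zero, add_zero, Nat.sub_zero, tableMonomial_apply_succ hn,
      add_sub_cancel_right]
    ring

lemma sub_eq_sub_of_tableMonomial_eq (hn : 2 ≤ n) {a b : (ZMod (n + 1) × ℕ) →₀ ℤ}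
    (h : tableMonomial a = tableMonomial b) (k : ℕ) (i j : ZMod (n + 1)) :
    a (i, k) - b (i, k) = a (j, k) - b (j, k) := by
  refine apply_eq_of_forall_sub_one (g := fun i => a (i, k) - b (i, k)) (fun i => ?_) i j
  have h1 := tableMonomial_diagonal_sum hn a k i
  rw [h, ← tableMonomial_diagonal_sum hn b k i] at h1
  show _ - _ = _ - _
  omega

lemma IsReducedTable.eq_of_tableMonomial_eq (hn : 2 ≤ n) {a b : (ZMod (n + 1) × ℕ) →₀ ℤ}
    (ha : IsReducedTable a) (hb : IsReducedTable b) (h : tableMonomial a = tableMonomial b) :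
    a = b := by
  obtain ⟨N, hN⟩ := exists_forall_level_eq_zero a
  obtain ⟨N', hN'⟩ := exists_forall_level_eq_zero b
  have hstep : ∀ k, (∀ i, a (i, k + 1) = b (i, k + 1)) → ∀ i, a (i, k) = b (i, k) := by
    intro k hk i
    -- The levels differ by a constant. Where `a` is tight, `a (j, k) = b (j - 1, k + 1) ≥ b (j,
    -- k)`, so the constant is nonnegative; where `b` is tight, it is nonpositive.
    have hc := sub_eq_sub_of_tableMonomial_eq hn h k
    obtain ⟨j, hj⟩ := ha.exists_eq k
    obtain ⟨j', hj'⟩ := hb.exists_eq k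
    have h1 := hb.le_left j k
    have h2 := ha.le_left j' k
    have h3 := hk (j - 1)
    have h4 := hk (j' - 1)
    have h5 := hc i j
    have h6 := hc i j'
    omega
  have hall : ∀ d k, max N N' ≤ k + d → ∀ i, a (i, k) = b (i, k) := by
    intro d
    induction d with
    | zero => intro k hk i; rw [hN i k (by omega), hN' i k (by omega)]
    | succ d ih => exact fun k hk => hstep k (ih (k + 1) (by omega))
  ext ⟨i, k⟩
  exact hall (max N N') k (by omega) i

lemma isReducedTable_zero : IsReducedTable (0 : (ZMod (n + 1) × ℕ) →₀ ℤ) :=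
  ⟨fun _ _ => le_rfl, fun _ _ => le_rfl, fun _ => ⟨0, rfl⟩⟩

lemma IsReducedTable.sub_single_kf (hn : 2 ≤ n) {a : (ZMod (n + 1) × ℕ) →₀ ℤ}
    (ha : IsReducedTable a) (i : ZMod (n + 1)) :
    IsReducedTable (a - Finsupp.single (i, kf i (tableMonomial a)) 1) := by
  set M := tableMonomial a with hM
  set k := kf i M with hk
  have hval : ∀ j l, (a - Finsupp.single (i, k) 1 : (ZMod (n + 1) × ℕ) →₀ ℤ) (j, l)
      = a (j, l) - if i = j ∧ k = l then 1 else 0 := by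
    intro j l; simp [Finsupp.single_apply]
  have hmax := phi_eq_partialSum_kf i M
  rw [← hk] at hmax
  -- Lowering `(i, k)` threatens only the inequality having it on the right. Minimality of `k_f`
  -- makes `y_{i,k}` positive, hence that inequality strict.
  have hright : ∀ l, k = l + 1 → a (i + 1, l) < a (i, l + 1) := by
    intro l hl
    have h1 : partialSum i M l < phi i M := partialSum_lt_of_lt_kf (by omega)
    rw [hmax, hl, partialSum_succ, hM, tableMonomial_apply_succ hn] at h1
    have h2 := ha.le_left i l
    omega
  refine ⟨fun j l => ?_, fun j l => ?_, fun l => ?_⟩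
  · rw [hval]
    have := ha.nonpos j l
    split_ifs <;> omega
  · rw [hval, hval]
    have h1 := ha.le_left j l
    by_cases h2 : i = j - 1 ∧ k = l + 1
    · have h3 := hright l h2.2
      rw [show i + 1 = j by rw [h2.1]; ring, h2.1] at h3
      split_ifs <;> omega
    · rw [if_neg h2]
      split_ifs <;> omega
  · simp only [hval]
    by_cases hl : k = l
    · obtain ⟨j, hj⟩ := ha.exists_eq l
      have hkl : ¬ k = l + 1 := by omega
      by_cases hij : i = j
      · subst hij
        -- The tight position `i` is lost, but `y_{i,k+1} ≤ 0` by maximality at `k`, which makes `i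
        -- + 1` tight.
        refine ⟨i + 1, ?_⟩
        rw [if_neg (fun h => add_one_ne_self hn i h.1.symm), if_neg (fun h => hkl h.2),
          add_sub_cancel_right]
        have h1 := partialSum_le_phi i M (k + 1)
        rw [hmax, partialSum_succ, hM, tableMonomial_apply_succ hn, hl] at h1
        have h2 := ha.le_left (i + 1) l
        rw [add_sub_cancel_right] at h2
        omega
      · exact ⟨j, by rw [if_neg (fun h => hij h.1), if_neg (fun h => hkl h.2), hj]⟩
    · obtain ⟨j, hj⟩ := ha.exists_eq l
      refine ⟨j, ?_⟩
      rw [if_neg (fun h => hl h.2)]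
      split_ifs with h
      · have h3 := hright l h.2
        rw [h.1, sub_add_cancel] at h3
        omega
      · omega

lemma IsReducedTable.add_single_ke (hn : 2 ≤ n) {a : (ZMod (n + 1) × ℕ) →₀ ℤ}
    (ha : IsReducedTable a) {i : ZMod (n + 1)} (hi : eps i (tableMonomial a) ≠ 0) :
    IsReducedTable (a + Finsupp.single (i, ke i (tableMonomial a)) 1) := by
  set M := tableMonomial a with hM
  set k := ke i M with hk
  have hval : ∀ j l, (a + Finsupp.single (i, k) 1 : (ZMod (n + 1) × ℕ) →₀ ℤ) (j, l)
      = a (j, l) + if i = j ∧ k = l then 1 else 0 := by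
    intro j l; simp [Finsupp.single_apply]
  obtain ⟨hmax, hlt⟩ := phi_eq_partialSum_ke_and_lt hi
  rw [← hk] at hmax hlt
  -- Maximality of `k_e` makes `y_{i,k+1}` negative, which leaves room to raise `(i, k)`; the raised
  -- entry stays nonpositive for the same reason.
  have hleft : a (i, k) < a (i - 1, k + 1) := by
    have h1 := hlt (k + 1) (by omega)
    rw [hmax, partialSum_succ, hM, tableMonomial_apply_succ hn] at h1
    have h2 := ha.le_left (i + 1) k
    rw [add_sub_cancel_right] at h2
    omega
  have hleft' := ha.nonpos (i - 1) (k + 1)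
  refine ⟨fun j l => ?_, fun j l => ?_, fun l => ?_⟩
  · rw [hval]
    have := ha.nonpos j l
    split_ifs with h
    · obtain ⟨rfl, rfl⟩ := h; omega
    · omega
  · rw [hval, hval]
    have h1 := ha.le_left j l
    split_ifs with h h'
    · omega
    · obtain ⟨rfl, rfl⟩ := h; omega
    · omega
    · omega
  · simp only [hval]
    obtain ⟨j, hj⟩ := ha.exists_eq l
    by_cases hl : k = l + 1
    · have hkl : ¬ k = l := by omega
      by_cases hij : i = j - 1
      -- Tightness at `j = i + 1` is lost, but `y_{i,k} ≥ 0` transfers it to `i`.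
      · refine ⟨i, ?_⟩
        rw [if_neg (fun h => hkl h.2), if_neg (fun h => sub_one_ne_self hn i h.1.symm)]
        have h1 := partialSum_le_phi i M l
        rw [hmax, hl, partialSum_succ, hM, tableMonomial_apply_succ hn] at h1
        have h2 := ha.le_left i l
        rw [← hij, show j = i + 1 by rw [hij]; ring] at hj
        omega
      · exact ⟨j, by rw [if_neg (fun h => hkl h.2), if_neg (fun h => hij h.1), hj]⟩
    · refine ⟨j, ?_⟩
      have hne : ¬ (i = j ∧ k = l) := by
        rintro ⟨rfl, rfl⟩
        omega
      rw [if_neg hne, if_neg (fun h => hl h.2), hj]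

lemma InComponent.exists_table (hn : 2 ≤ n) {M : Monomial n} (hM : InComponent M) :
    ∃ a, IsReducedTable a ∧ tableMonomial a = M := by
  induction hM with
  | one => exact ⟨0, isReducedTable_zero, map_zero _⟩
  | f i _ ih =>
    obtain ⟨a, ha, rfl⟩ := ih
    refine ⟨_, ha.sub_single_kf hn i, ?_⟩
    rw [tableMonomial_sub, tableMonomial_single, one_smul, fOp, sub_eq_neg_add]
  | e i _ h ih =>
    obtain ⟨a, ha, rfl⟩ := ih
    rw [eOp] at h
    split_ifs at h with h0
    refine ⟨_, ha.add_single_ke hn h0, ?_⟩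
    rw [← Option.some.inj h, tableMonomial_add, tableMonomial_single, one_smul, add_comm]

/-! ### The `δ`-coefficient -/

lemma tableDelta_eq_sum {a : (ZMod (n + 1) × ℕ) →₀ ℤ} {N : ℕ}
    (hN : ∀ i k, N ≤ k → a (i, k) = 0) : tableDelta a = ∑ k ∈ Finset.range N, a (0, k) := by
  rw [tableDelta, linearCombination_eq_sum _ a hN, Finset.sum_comm]
  simp

lemma exists_deltaCoeff (hn : 2 ≤ n) : ∃ D : MInf n → ℤ, IsDeltaCoeff D ∧
    ∀ M a, IsReducedTable a → tableMonomial a = M.1 → D M = tableDelta a := by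
  choose t ht using fun M : MInf n => InComponent.exists_table hn M.2
  have hD : ∀ M a, IsReducedTable a → tableMonomial a = M.1 → tableDelta (t M) = tableDelta a :=
    fun M a ha haM => by rw [(ht M).1.eq_of_tableMonomial_eq hn ha ((ht M).2.trans haM.symm)]
  refine ⟨fun M => tableDelta (t M), ⟨?_, isAbstractCrystal_of_fOp hn fun i M N h => ?_⟩, hD⟩
  · rw [wt_eq hn, hD _ 0 isReducedTable_zero (map_zero _)]
    simp [tableDelta, MInf.one, clWeight]
  · rw [hD N _ ((ht M).1.sub_single_kf hn i)]
    · simp [tableDelta]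
    · rw [tableMonomial_sub, tableMonomial_single, one_smul, ← h, (ht M).2, fOp, sub_eq_neg_add]

lemma IsDeltaCoeff.eq (hn : 2 ≤ n) {D D' : MInf n → ℤ} (hD : IsDeltaCoeff D)
    (hD' : IsDeltaCoeff D') : D = D' := by
  have hstep : ∀ {D : MInf n → ℤ}, IsDeltaCoeff D → ∀ i (M N : MInf n), MInf.f i M = some N →
      D N = D M - if i = 0 then 1 else 0 := by
    intro D hD i M N h
    have := congrArg Prod.snd (hD.2.wt_f i M N h)
    simpa [wt_eq hn, simpleRoot] using this
  suffices ∀ M (hM : InComponent M), D ⟨M, hM⟩ = D' ⟨M, hM⟩ from funext fun M => this M.1 M.2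
  intro M hM
  induction hM with
  | one =>
    have h1 := congrArg Prod.snd hD.1
    have h2 := congrArg Prod.snd hD'.1
    rw [wt_eq hn] at h1 h2
    exact h1.trans h2.symm
  | @f i M hM ih =>
    have h := (MInf.f_eq_some_iff i (⟨M, hM⟩ : MInf n) ⟨fOp i M, hM.f i⟩).2 rfl
    rw [hstep hD _ _ _ h, hstep hD' _ _ _ h, ih]
  | @e i M N hM he ih =>
    have h := (MInf.f_eq_some_iff i (⟨N, hM.e i he⟩ : MInf n) ⟨M, hM⟩).2
      ((eOp_eq_some_iff hn i N M).1 he)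
    have h1 := hstep hD _ _ _ h
    have h2 := hstep hD' _ _ _ h
    omega

/-! ### The algorithm -/

lemma IsSolution.add_const {M : MInf n} {k : ℕ} {b : ZMod (n + 1) → ℤ} (hb : IsSolution M k b)
    (c : ℤ) : IsSolution M k fun i => b i + c := fun i => by
  rw [← hb i]; ring

lemma IsSolution.exists_eq_add_const {M : MInf n} {k : ℕ} {b b' : ZMod (n + 1) → ℤ}
    (hb : IsSolution M k b) (hb' : IsSolution M k b') : ∃ c, ∀ i, b' i = b i + c := by
  refine ⟨b' 0 - b 0, fun i => ?_⟩
  have := apply_eq_of_forall_sub_one (g := fun i => b' i - b i)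
    (fun i => by have h1 := hb i; have h2 := hb' i; show _ - _ = _ - _; omega) i 0
  omega

lemma exists_isGreatest_stepCandidates {M : MInf n} {k : ℕ} {b : ZMod (n + 1) → ℤ}
    (hb : IsSolution M k b) (c : ZMod (n + 1) → ℤ) : ∃ b', IsGreatest (stepCandidates M k c) b' := by
  -- All solutions are shifts of `b`; the largest admissible shift is the smallest slack, attained
  -- at `j`.
  obtain ⟨j, -, hj⟩ := Finset.exists_min_image Finset.univ (fun i => min 0 (c (i - 1)) - b i)
    ⟨(0 : ZMod (n + 1)), Finset.mem_univ _⟩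
  refine ⟨fun i => b i + (min 0 (c (j - 1)) - b j), ⟨hb.add_const _, fun i => ?_, fun i => ?_⟩, ?_⟩
  · have := hj i (Finset.mem_univ _); dsimp only at this ⊢; omega
  · have := hj i (Finset.mem_univ _); dsimp only at this ⊢; omega
  · rintro b' ⟨hs, h0, hc⟩ i
    obtain ⟨d, hd⟩ := hb.exists_eq_add_const hs
    have h1 := h0 j
    have h2 := hc j
    rw [hd] at h1 h2
    rw [hd]
    dsimp only
    omega

lemma eq_of_mem_topCandidates {M : MInf n} {m : ℕ} {b b' : ZMod (n + 1) → ℤ}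
    (hb : b ∈ topCandidates M m) (hb' : b' ∈ topCandidates M m) : b = b' := by
  obtain ⟨hs, h0, j, hj⟩ := hb
  obtain ⟨hs', h0', j', hj'⟩ := hb'
  obtain ⟨c, hc⟩ := hs.exists_eq_add_const hs'
  funext i
  have h1 := h0 j'
  have h2 := h0' j
  have h3 := hc i
  have h4 := hc j
  have h5 := hc j'
  omega

lemma IsRun.eq {M : MInf n} {m : ℕ} {a a' : ℕ → ZMod (n + 1) → ℤ} (ha : IsRun M m a)
    (ha' : IsRun M m a') : a = a' := by
  have hle : ∀ d k, k + d = m → a k = a' k := by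
    intro d
    induction d with
    | zero => rintro k rfl; exact eq_of_mem_topCandidates ha.top ha'.top
    | succ d ih =>
      intro k hk
      have h1 := ha.step k (by omega)
      rw [ih (k + 1) (by omega)] at h1
      exact h1.unique (ha'.step k (by omega))
  funext k
  rcases le_or_gt k m with h | h
  · exact hle (m - k) k (by omega)
  · rw [ha.above k h, ha'.above k h]

lemma isSolution_of_tableMonomial_eq (hn : 2 ≤ n) {M : MInf n} {a : (ZMod (n + 1) × ℕ) →₀ ℤ}
    (haM : tableMonomial a = M.1) (k : ℕ) : IsSolution M k fun i => a (i, k) := fun i => by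
  rw [tableMonomial_diagonal_sum hn, haM]; rfl

/-- The algorithm finds the reduced table of a monomial. -/
lemma IsReducedTable.exists_isRun (hn : 2 ≤ n) {M : MInf n} (hM : M ≠ MInf.one n)
    {a : (ZMod (n + 1) × ℕ) →₀ ℤ} (ha : IsReducedTable a) (haM : tableMonomial a = M.1) :
    ∃ m, IsGreatest {m : ℕ | ∃ i, M.y i (m + 1) ≠ 0} m ∧ IsRun M m fun k i => a (i, k) := by
  have ha0 : a.support.Nonempty := by
    rw [Finsupp.support_nonempty_iff]
    rintro rfl
    exact hM (Subtype.ext (haM.symm.trans (map_zero _)))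
  obtain ⟨⟨i₀, m⟩, hm, hmax⟩ := Finset.exists_max_image _ Prod.snd ha0
  have habove : ∀ i k, m < k → a (i, k) = 0 := by
    intro i k hk
    by_contra h
    exact absurd (hmax _ (Finsupp.mem_support_iff.2 h)) (not_le.2 hk)
  have hsol := isSolution_of_tableMonomial_eq hn haM
  have hy : ∀ i k, M.y i (k + 1) = (a (i, k + 1) - a (i - 1, k + 1)) - (a (i + 1, k) - a (i, k)) := by
    intro i k; rw [← tableMonomial_apply_succ hn, haM]; rfl
  obtain ⟨j, hj⟩ := ha.exists_eq m
  rw [habove _ _ (Nat.lt_succ_self m)] at hj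
  refine ⟨m, ⟨?_, ?_⟩, ⟨hsol m, fun i => ha.nonpos i m, j, hj⟩, fun k _ => ⟨⟨hsol k,
    fun i => ha.nonpos i k, fun i => ha.le_left i k⟩, ?_⟩, fun k hk => funext fun i => habove i k hk⟩
  -- If all `y_{i,m+1}` vanished, level `m` would be constant, hence zero because its entry at `j`
  -- is zero, contrary to the choice of `m`.
  · by_contra hcon
    simp only [Set.mem_ofPred_eq, not_exists, not_not] at hcon
    apply Finsupp.mem_support_iff.1 hm
    rw [← hj]
    refine apply_eq_of_forall_sub_one (g := fun i => a (i, m)) (fun i => ?_) i₀ j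
    have h := hcon (i - 1)
    rw [hy, habove _ _ (Nat.lt_succ_self m), habove _ _ (Nat.lt_succ_self m), sub_add_cancel] at h
    show a (i, m) = a (i - 1, m)
    omega
  · rintro k ⟨i, hi⟩
    by_contra hk
    rw [not_le] at hk
    apply hi
    rw [hy, habove _ _ hk, habove _ _ hk, habove _ (k + 1) (by omega),
      habove _ (k + 1) (by omega)]
    norm_num
  · rintro b ⟨hs, h0, hc⟩ i
    obtain ⟨c, hcc⟩ := (hsol k).exists_eq_add_const hs
    -- At a tight index the bound on candidates is the table entry itself, so no candidate is a
    -- positive shift of it.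
    obtain ⟨j', hj'⟩ := ha.exists_eq k
    have h1 := hc j'
    rw [hcc, hj'] at h1
    rw [hcc]
    dsimp only at h1 ⊢
    omega

/-! ### Generalized Young walls and their tables -/

lemma mem_boxes_iff {Y : YoungWall} {i : ZMod (n + 1)} {k p : ℕ} :
    p ∈ (Y.support.filter fun p => k < Y p ∧ color n p k = i) ↔ k < Y p ∧ color n p k = i := by
  rw [Finset.mem_filter, Finsupp.mem_support_iff]
  exact ⟨fun h => h.2, fun h => ⟨by omega, h⟩⟩

/-- Rows have no gaps, and one step left along a row lowers the color by one, so each box counted on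
the left has a right neighbour counted on the right. -/
lemma boxCount_sub_one_le (Y : YoungWall) (i : ZMod (n + 1)) (k : ℕ) :
    boxCount Y (i - 1) (k + 1) ≤ boxCount Y i k := by
  refine Finset.card_le_card fun p hp => ?_
  rw [mem_boxes_iff] at hp ⊢
  refine ⟨by omega, ?_⟩
  have h := hp.2
  rw [color] at h ⊢
  push_cast at h
  linear_combination h

lemma boxCount_eq_zero {Y : YoungWall} {k : ℕ} (hk : Y.support.sup Y ≤ k) (i : ZMod (n + 1)) :
    boxCount Y i k = 0 := by
  rw [boxCount, Finset.card_eq_zero, Finset.filter_eq_empty_iff]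
  intro p hp h
  have := Finset.le_sup (f := Y) hp
  omega

/-- The row which is the `q`th one among the rows whose site in column `k + 1` is `i`-colored. -/
def coloredRow (i : ZMod (n + 1)) (k q : ℕ) : ℕ := (i + (k : ZMod (n + 1))).val + (n + 1) * q

lemma color_coloredRow (i : ZMod (n + 1)) (k q : ℕ) : color n (coloredRow i k q) k = i := by
  simp [color, coloredRow]

lemma coloredRow_div (i : ZMod (n + 1)) (k q : ℕ) : coloredRow i k q / (n + 1) = q := by
  rw [coloredRow, Nat.add_mul_div_left _ _ (Nat.succ_pos n),
    Nat.div_eq_of_lt (ZMod.val_lt _), zero_add]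

lemma coloredRow_color (k p : ℕ) : coloredRow (color n p k) k (p / (n + 1)) = p := by
  rw [coloredRow, color, sub_add_cancel, ZMod.val_natCast, Nat.mod_add_div]

lemma coloredRow_injective (i : ZMod (n + 1)) (k : ℕ) : Function.Injective (coloredRow i k) :=
  fun q q' h => by rw [← coloredRow_div i k q, h, coloredRow_div]

lemma boxCount_eq_of_lt_iff {Y : YoungWall} {i : ZMod (n + 1)} {k c : ℕ}
    (h : ∀ q, k < Y (coloredRow i k q) ↔ q < c) : boxCount Y i k = c := by
  have : (Y.support.filter fun p => k < Y p ∧ color n p k = i)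
      = (Finset.range c).map ⟨coloredRow i k, coloredRow_injective i k⟩ := by
    ext p
    rw [mem_boxes_iff, Finset.mem_map]
    constructor
    · rintro ⟨hp, rfl⟩
      refine ⟨p / (n + 1), ?_, coloredRow_color k p⟩
      rw [Finset.mem_range, ← h, coloredRow_color]
      exact hp
    · rintro ⟨q, hq, rfl⟩
      exact ⟨(h q).2 (Finset.mem_range.1 hq), color_coloredRow i k q⟩
  rw [boxCount, this, Finset.card_map, Finset.card_range]

/-- Properness makes row lengths antitone in `q`, so the rows reaching column `k + 1` form an
initial segment, whose size is the box count. -/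
lemma IsProperWall.lt_coloredRow_iff {Y : YoungWall} (hY : IsProperWall n Y) (i : ZMod (n + 1))
    (k q : ℕ) : k < Y (coloredRow i k q) ↔ q < boxCount Y i k := by
  have hanti : Antitone fun q => Y (coloredRow i k q) := by
    intro q q' hq
    rcases hq.eq_or_lt with rfl | hq
    · exact le_rfl
    · refine hY _ _ ?_ ?_
      · exact Nat.add_lt_add_left (Nat.mul_lt_mul_of_pos_left hq (Nat.succ_pos n)) _
      · simp [coloredRow, Nat.ModEq]
  have hex : ∃ q, ¬ k < Y (coloredRow i k q) := by
    obtain ⟨q, hq⟩ := Infinite.exists_notMem_finset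
      (Y.support.preimage (coloredRow i k) (coloredRow_injective i k).injOn)
    refine ⟨q, ?_⟩
    rw [Finset.mem_preimage, Finsupp.notMem_support_iff] at hq
    omega
  classical
  have key : ∀ q, k < Y (coloredRow i k q) ↔ q < Nat.find hex := by
    intro q
    constructor
    · intro h
      by_contra hq
      exact Nat.find_spec hex (h.trans_le (hanti (not_lt.1 hq)))
    · intro h
      exact not_not.1 (Nat.find_min hex h)
  rw [key, boxCount_eq_of_lt_iff key]

lemma IsProperWall.lt_iff {Y : YoungWall} (hY : IsProperWall n Y) (k p : ℕ) :
    k < Y p ↔ p / (n + 1) < boxCount Y (color n p k) k := by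
  rw [← hY.lt_coloredRow_iff, coloredRow_color]

lemma IsProperWall.eq_of_boxCount_eq {Y Y' : YoungWall} (hY : IsProperWall n Y)
    (hY' : IsProperWall n Y') (h : ∀ i k, boxCount (n := n) Y i k = boxCount Y' i k) : Y = Y' := by
  ext p
  refine eq_of_forall_lt_iff fun k => ?_
  rw [hY.lt_iff, hY'.lt_iff, h]

/-- The table `-b_{i,k+1}(Y)`. -/
noncomputable def wallTable (n : ℕ) (Y : YoungWall) : (ZMod (n + 1) × ℕ) →₀ ℤ :=
  Finsupp.onFinset (Finset.univ ×ˢ Finset.range (Y.support.sup Y))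
    (fun p => -(boxCount Y p.1 p.2 : ℤ)) fun p hp => by
      rw [Finset.mem_product, Finset.mem_range]
      refine ⟨Finset.mem_univ _, ?_⟩
      by_contra h
      exact hp (by rw [boxCount_eq_zero (not_lt.1 h)]; rfl)

lemma wallTable_apply (Y : YoungWall) (i : ZMod (n + 1)) (k : ℕ) :
    wallTable n Y (i, k) = -(boxCount Y i k : ℤ) := rfl

lemma tableMonomial_wallTable (Y : YoungWall) : tableMonomial (wallTable n Y) = Psi n Y := by
  rw [tableMonomial, linearCombination_eq_sum (N := Y.support.sup Y)]
  · rfl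
  · intro i k hk
    rw [wallTable_apply, boxCount_eq_zero hk]; rfl

/-- For any wall the two inequalities are automatic; only tightness has content, and it says that no
`δ` is removable. -/
lemma isReducedTable_wallTable_iff (Y : YoungWall) :
    IsReducedTable (wallTable n Y) ↔ IsReducedWall n Y := by
  constructor
  · intro h k hk
    obtain ⟨i, hi⟩ := h.exists_eq k
    have := hk i
    rw [wallTable_apply, wallTable_apply] at hi
    omega
  · intro h
    refine ⟨fun i k => ?_, fun i k => ?_, fun k => ?_⟩
    · rw [wallTable_apply]; omega
    · have := boxCount_sub_one_le Y i k
      rw [wallTable_apply, wallTable_apply]; omega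
    · obtain ⟨i, hi⟩ := not_forall.1 (h k)
      have := boxCount_sub_one_le Y i k
      exact ⟨i, by rw [wallTable_apply, wallTable_apply]; omega⟩

lemma IsReducedTable.exists_wall {a : (ZMod (n + 1) × ℕ) →₀ ℤ} (ha : IsReducedTable a) :
    ∃ Y, IsProperWall n Y ∧ wallTable n Y = a := by
  classical
  obtain ⟨N, hN⟩ := exists_forall_level_eq_zero a
  have hex : ∀ p : ℕ, ∃ k, -a (color n p k, k) ≤ (p / (n + 1) : ℕ) := fun p =>
    ⟨N, by rw [hN _ _ le_rfl, neg_zero]; exact Int.natCast_nonneg _⟩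
  -- Row `p` must reach column `k + 1` exactly when `p / (n + 1) < -a (color n p k, k)`. By
  -- `le_left` this condition is downward closed in `k`, so the first failure is the row length.
  let len : ℕ → ℕ := fun p => Nat.find (hex p)
  have hlen : ∀ p k, k < len p ↔ (p / (n + 1) : ℕ) < -a (color n p k, k) := by
    intro p k
    have hmono : Monotone fun k => a (color n p k, k) := by
      refine monotone_nat_of_le_succ fun k => ?_
      have h := ha.le_left (color n p k) k
      rwa [show color n p k - 1 = color n p (k + 1) by simp [color, sub_sub]] at h
    constructor
    · intro h
      exact not_le.1 (Nat.find_min (hex p) h)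
    · intro h
      by_contra hk
      have h1 := Nat.find_spec (hex p)
      have h2 := hmono (not_lt.1 hk)
      change a (color n p (Nat.find (hex p)), Nat.find (hex p)) ≤ a (color n p k, k) at h2
      omega
  -- A nonempty row has a box in the first column, which bounds `p / (n + 1)` by the largest `-a (i,
  -- 0)`.
  have hfin : (Function.support len).Finite := by
    obtain ⟨B, hB⟩ := (Set.finite_range fun i : ZMod (n + 1) => -a (i, 0)).bddAbove
    refine (Set.finite_lt_nat ((n + 1) * B.toNat)).subset fun p hp => ?_
    have h1 := (hlen p 0).1 (Nat.pos_of_ne_zero hp)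
    have h2 : -a (color n p 0, 0) ≤ B := hB ⟨color n p 0, rfl⟩
    have h3 : p / (n + 1) < B.toNat := by omega
    rwa [Nat.div_lt_iff_lt_mul (Nat.succ_pos n), mul_comm] at h3
  refine ⟨Finsupp.ofSupportFinite len hfin, fun p q hqp hpq => ?_, ?_⟩
  · change len p ≤ len q
    refine le_of_forall_lt fun k hk => ?_
    rw [hlen] at hk ⊢
    have hc : (p : ZMod (n + 1)) = q := (ZMod.natCast_eq_natCast_iff _ _ _).2 hpq
    rw [color, ← hc, ← color]
    have := Nat.div_le_div_right (c := n + 1) hqp.le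
    omega
  · ext ⟨i, k⟩
    rw [wallTable_apply, boxCount_eq_of_lt_iff (c := (-a (i, k)).toNat)]
    · have := ha.nonpos i k
      omega
    · intro q
      change k < len _ ↔ _
      rw [hlen, color_coloredRow, coloredRow_div]
      omega

end AffineMonomial

open AffineMonomial
theorem theorem3p6 (n : ℕ) (hn : 2 ≤ n) :
    (∃! D : MInf n → ℤ, IsDeltaCoeff D) ∧
    ∀ D : MInf n → ℤ, IsDeltaCoeff D →
      D (MInf.one n) = 0 ∧
      ∀ M : MInf n, M ≠ MInf.one n →
        -- step 1
        ∃ m : ℕ, IsGreatest {m : ℕ | ∃ i, M.y i (m + 1) ≠ 0} m ∧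
        -- step 2 is well defined
        (∃! b, b ∈ topCandidates M m) ∧
        -- step 3 is well defined
        (∀ k, k < m → ∀ c, ∃ b, IsGreatest (stepCandidates M k c) b) ∧
        -- the algorithm has exactly one output
        ∃ a : ℕ → ZMod (n + 1) → ℤ, IsRun M m a ∧ (∀ a', IsRun M m a' → a' = a) ∧
          -- which is given by the only proper reduced generalized Young wall of `M`
          (∃ Y : YoungWall, (IsProperWall n Y ∧ IsReducedWall n Y ∧ Psi n Y = M.1) ∧
            (∀ Y' : YoungWall, IsProperWall n Y' ∧ IsReducedWall n Y' ∧ Psi n Y' = M.1 → Y' = Y) ∧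
            ∀ i k, a k i = -(boxCount Y i k : ℤ)) ∧
          -- and computes `D(M)`
          D M = ∑ k ∈ Finset.range (m + 1), a k 0 := by
  obtain ⟨D₀, hD₀, htable⟩ := exists_deltaCoeff hn
  refine ⟨⟨D₀, hD₀, fun D hD => hD.eq hn hD₀⟩, fun D hD => ?_⟩
  obtain rfl := hD.eq hn hD₀
  refine ⟨(htable _ 0 isReducedTable_zero (map_zero _)).trans (map_zero _), fun M hM => ?_⟩
  obtain ⟨a, ha, haM⟩ := InComponent.exists_table hn M.2
  obtain ⟨m, hm, hrun⟩ := ha.exists_isRun hn hM haM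
  obtain ⟨Y, hY, hYa⟩ := ha.exists_wall
  refine ⟨m, hm, ⟨_, hrun.top, fun b hb => eq_of_mem_topCandidates hb hrun.top⟩,
    fun k _ c => exists_isGreatest_stepCandidates (isSolution_of_tableMonomial_eq hn haM k) c,
    _, hrun, fun a' ha' => ha'.eq hrun, ⟨Y, ⟨hY, ?_, ?_⟩, ?_, ?_⟩, ?_⟩
  · rwa [← isReducedTable_wallTable_iff, hYa]
  · rw [← tableMonomial_wallTable, hYa, haM]
  · rintro Y' ⟨hY', hred, hPsi⟩
    rw [← isReducedTable_wallTable_iff] at hred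
    rw [← tableMonomial_wallTable, ← haM] at hPsi
    have hY'a := hred.eq_of_tableMonomial_eq hn ha hPsi
    refine hY'.eq_of_boxCount_eq hY fun i k => ?_
    have h := DFunLike.congr_fun (hY'a.trans hYa.symm) (i, k)
    rw [wallTable_apply, wallTable_apply] at h
    omega
  · intro i k
    rw [← wallTable_apply, hYa]
  · rw [htable M a ha haM, tableDelta_eq_sum]
    exact fun i k hk => congrFun (hrun.above k (by omega)) i
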